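/- Let $k\ge 1$ be a fixed integer. For $m\ge 1$ put $n=km$, let $J_m$ be the $m\times m$ all-ones matrix, let $$A_n=\begin{pmatrix}0&J_m&\cdots&J_m\\ J_m&0&\cdots&0\\ \vdots&&&\vdots\\ J_m&0&\cdots&0\end{pmatrix}\in\mathbb R^{n\times n}$$ ($k\times k$ blocks), and let $V_n=\frac1n A_n\odot A_n$ be the normalized variance profile. Then the spectral radius of $V_n$ is $\rho(V_n)=\frac{\sqrt{k-1}}{k}$. Put $\rho^*=\sqrt{\rho(V_n)}=\frac{(k-1)^{1/4}}{\sqrt k}$. For $s>0$ the Master Equations are the system $$q_i=\frac{(V_n^{\mathsf T}q)_i}{s^2+(V_n\tilde q)_i(V_n^{\mathsf T}q)_i},\qquad \tilde q_i=\frac{(V_n\tilde q)_i}{s^2+(V_n\tilde q)_i(V_n^{\mathsf T}q)_i},\qquad \sum_i q_i=\sum_i\tilde q_i,\qquad q_i,\tilde q_i\ge 0\quad(1\le i\le n).$$ 1. The following hold along $n=km$, $m\ge1$. (A1, bounded variances) The entries of $A_n$ are bounded uniformly in $n$. (A2, admissibility) For every $s>0$ there is $C=C(s)>0$ such that for all $m\ge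 1$ and $t\in(0,1]$ the system $$r_i=\frac{(V_n^{\mathsf T}r)_i+t}{s^2+((V_n\tilde r)_i+t)((V_n^{\mathsf T}r)_i+t)},\qquad \tilde r_i=\frac{(V_n\tilde r)_i+t}{s^2+((V_n\tilde r)_i+t)((V_n^{\mathsf T}r)_i+t)}\qquad(1\le i\le n)$$ has a unique entrywise positive solution $(r,\tilde r)$, and $\frac1n\sum_i r_i\le C$. 2. Assume $k\ge2$. For $0<s<\rho^*$ the Master Equations have a unique non-zero solution $(q(s),\tilde q(s))$; put $(q(s),\tilde q(s))=0$ for $s\ge\rho^*$, $F_n(s)=1-\frac1n\langle q(s),V_n\tilde q(s)\rangle$ for $s>0$, and $F_n(0)=\lim_{s\downarrow0}F_n(s)$. Then $F_n$ does not depend on $n$ and is given by $$F_n(s)=F_\infty(s)=\frac1k\sqrt{(k-2)^2+4k^2s^4}\quad\text{if }0\le s\le\rho^*,\qquad F_\infty(s)=1\quad\text{if }s>\rho^*.$$ In particular $F_\infty(0)=1-\frac2k$ and $\lim_{s\uparrow\rho^*}F_\infty(s)=1$. 3. Assume $k\ge2$. There is a unique probability measure $\mu_n$ on $\mathbb C$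 that is radially symmetric (invariant under all rotations about $0$) and satisfies $\mu_n(\{|z|\le s\})=F_n(s)$ for all $s>0$. It does not depend on $n$ and equals $$\mu_\infty(dz)=\Big(1-\frac2k\Big)\delta_0(dz)+\varphi_\infty(|z|)\,\ell(dz),\qquad \varphi_\infty(|z|)=\frac{4k}{\pi}\,\frac{|z|^2}{\sqrt{(k-2)^2+4k^2|z|^4}}\,\mathbf 1_{\{|z|\le\rho^*\}},$$ where $\ell$ is Lebesgue measure on $\mathbb C$; and $\varphi_\infty(s)=\frac1{2\pi s}F_n'(s)$ for $0<s<\rho^*$. If $k\ge3$, then $\varphi_\infty(0)=0$ and $\varphi_\infty$ is continuous at $0$. -/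

import Mathlib

open Filter Topology MeasureTheory
open scoped Matrix

namespace VarianceProfile

noncomputable section

/-- The normalized variance profile `V = (1/n) A ⊙ A` of a standard deviation profile `A`. -/
def normVar {n : ℕ} (A : Matrix (Fin n) (Fin n) ℝ) : Matrix (Fin n) (Fin n) ℝ :=
  (n : ℝ)⁻¹ • (A ⊙ A)

/-- The spectral radius `max {|λ| : λ a complex eigenvalue of V}` of a real square matrix, as a
real number (the spectrum of a matrix is finite, so `toReal` loses nothing). -/
def specRad {n : ℕ} (V : Matrix (Fin n) (Fin n) ℝ) : ℝ :=
  (spectralRadius ℂ (V.map Complex.ofReal)).toReal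

/-- Bounded variances for a family of standard deviation profiles `A i`,
of size `d i`. -/
def BoundedVariances {I : Type*} {d : I → ℕ}
    (A : ∀ i, Matrix (Fin (d i)) (Fin (d i)) ℝ) : Prop :=
  ∃ σmax : ℝ, 0 < σmax ∧ ∀ i a b, A i a b ≤ σmax

/-- `p = (r, r̃)` is an entrywise positive solution of the Regularized Master Equations with
parameters `s`, `t`. -/
structure IsRegularizedSolution {n : ℕ} (V : Matrix (Fin n) (Fin n) ℝ) (s t : ℝ)
    (p : (Fin n → ℝ) × (Fin n → ℝ)) : Prop where
  pos_fst : ∀ i, 0 < p.1 i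
  pos_snd : ∀ i, 0 < p.2 i
  eq_fst : ∀ i, p.1 i =
    ((Vᵀ *ᵥ p.1) i + t) / (s ^ 2 + ((V *ᵥ p.2) i + t) * ((Vᵀ *ᵥ p.1) i + t))
  eq_snd : ∀ i, p.2 i =
    ((V *ᵥ p.2) i + t) / (s ^ 2 + ((V *ᵥ p.2) i + t) * ((Vᵀ *ᵥ p.1) i + t))

/-- Admissibility of a family of standard deviation profiles `A i`, of size `d i`:
for each `s > 0` there is a constant `C`, uniform over the family and over `t ∈ (0, 1]`, such that
the positive solution `(r, r̃)` of the Regularized Master Equations (which exists and is unique)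
satisfies `(1/n) ∑ᵢ rᵢ ≤ C`. -/
def Admissible {I : Type*} {d : I → ℕ}
    (A : ∀ i, Matrix (Fin (d i)) (Fin (d i)) ℝ) : Prop :=
  ∀ s : ℝ, 0 < s → ∃ C : ℝ, 0 < C ∧ ∀ (i : I) (t : ℝ), 0 < t → t ≤ 1 →
    (∃! p, IsRegularizedSolution (normVar (A i)) s t p) ∧
    ∀ p, IsRegularizedSolution (normVar (A i)) s t p →
      1 / (d i : ℝ) * ∑ a, p.1 a ≤ C

/-- `p = (q, q̃)` is an entrywise nonnegative solution of the Master Equations with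
parameter `s`. -/
structure IsMasterSolution {n : ℕ} (V : Matrix (Fin n) (Fin n) ℝ) (s : ℝ)
    (p : (Fin n → ℝ) × (Fin n → ℝ)) : Prop where
  nonneg_fst : ∀ i, 0 ≤ p.1 i
  nonneg_snd : ∀ i, 0 ≤ p.2 i
  eq_fst : ∀ i, p.1 i = (Vᵀ *ᵥ p.1) i / (s ^ 2 + (V *ᵥ p.2) i * (Vᵀ *ᵥ p.1) i)
  eq_snd : ∀ i, p.2 i = (V *ᵥ p.2) i / (s ^ 2 + (V *ᵥ p.2) i * (Vᵀ *ᵥ p.1) i)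
  sum_eq : ∑ i, p.1 i = ∑ i, p.2 i

open Classical in
/-- `(q(s), q̃(s))`: the nontrivial solution of the Master Equations if `s < √ρ(V)`, and zero if
`s ≥ √ρ(V)`. -/
def masterSolution {n : ℕ} (V : Matrix (Fin n) (Fin n) ℝ) (s : ℝ) :
    (Fin n → ℝ) × (Fin n → ℝ) :=
  if h : s < √(specRad V) ∧ ∃ p, p ≠ 0 ∧ IsMasterSolution V s p then h.2.choose else 0

/-- The function `1 - (1/n) ⟨q(s), V q̃(s)⟩`, meant for `s > 0`. -/
def masterF {n : ℕ} (V : Matrix (Fin n) (Fin n) ℝ) (s : ℝ) : ℝ :=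
  1 - 1 / (n : ℝ) * ((masterSolution V s).1 ⬝ᵥ (V *ᵥ (masterSolution V s).2))

/-- The function `F_n` on `[0, ∞)`: it is `1 - (1/n) ⟨q(s), V q̃(s)⟩` for `s > 0`, extended to
`s = 0` by its limit. -/
def radialCDF {n : ℕ} (V : Matrix (Fin n) (Fin n) ℝ) (s : ℝ) : ℝ :=
  if 0 < s then masterF V s else limUnder (𝓝[>] (0 : ℝ)) (masterF V)

/-- `μ` is the measure `μ_n` attached to the normalized variance profile `V`: a radially symmetric
probability measure on `ℂ` with `μ {|z| ≤ s} = F_n(s)` for all `s > 0`. -/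
structure IsMasterMeasure {n : ℕ} (V : Matrix (Fin n) (Fin n) ℝ) (μ : Measure ℂ) : Prop where
  prob : IsProbabilityMeasure μ
  radial : ∀ u : Circle, μ.map (fun z : ℂ => (u : ℂ) * z) = μ
  cdf : ∀ s : ℝ, 0 < s → μ.real {z : ℂ | ‖z‖ ≤ s} = radialCDF V s

/-- The `km × km` matrix made of `k × k` blocks of size `m × m`, with blocks `J_m` (all ones)
in the first block row and the first block column except for the zero diagonal block, and all other
blocks zero. An index lies in the first block iff its value is `< m`. -/
def blockProfile (k m : ℕ) : Matrix (Fin (k * m)) (Fin (k * m)) ℝ :=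
  Matrix.of fun i j =>
    if (i.val < m ∧ ¬ j.val < m) ∨ (¬ i.val < m ∧ j.val < m) then 1 else 0

/-- `ρ* = (k-1)^{1/4} / √k`. -/
def rhoStar (k : ℕ) : ℝ := ((k : ℝ) - 1) ^ (1 / 4 : ℝ) / √(k : ℝ)

/-- The density `φ_∞`, as a function of `r = |z|`. -/
def phiInf (k : ℕ) (r : ℝ) : ℝ :=
  if r ≤ rhoStar k then
    4 * k / Real.pi * (r ^ 2 / √(((k : ℝ) - 2) ^ 2 + 4 * k ^ 2 * r ^ 4))
  else 0

/-- The measure `(1 - 2/k) δ₀(dz) + φ_∞(|z|) ℓ(dz)` on `ℂ`. -/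
def muInf (k : ℕ) : Measure ℂ :=
  ENNReal.ofReal (1 - 2 / (k : ℝ)) • Measure.dirac 0 +
    volume.withDensity (fun z : ℂ => ENNReal.ofReal (phiInf k ‖z‖))

end

end VarianceProfile

/-! The matrix `V` sees a vector only through its normalized sums over the first block and over the
rest, and its image is block-constant with these two numbers swapped. Hence every solution of either
system is block-constant, and everything reduces to a few scalars, uniformly in `m`.

For `t > 0`, once the common denominators are frozen, both components solve the same invertible
linear 2×2 system, so `r = r̃`. The remaining pair `(p, u)` exists by the intermediate value theorem
and is unique by a Cauchy–Schwarz argument (`regularized_scalar_unique`). Each entry has the form `u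
/ (s² + u²) ≤ 1 / (2s)`, which is admissibility.

For `t = 0` the sum condition forces `q = q̃`. The product `w` of the two block sums satisfies `(1/k
- w)((k-1)/k - w) = s⁴`, whose roots add up to 1; positivity selects the smaller one
(`master_scalar`). Since `(1/n)⟨q, V q̃⟩ = 2w`, the function `F` is the square root of the
discriminant.

A rotation invariant measure is determined by the law of the modulus (`radial_measure_ext`), so `F`
fixes `μ`; polar coordinates and the fundamental theorem of calculus show that `muInf` has this
radial law. -/

namespace VarianceProfile

/-! ### Reduction to block-constant vectors -/

/-- The vector that is `α` on the first block and `β` on the other ones. -/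
def blockVec (N m : ℕ) (α β : ℝ) : Fin N → ℝ := fun i => if i.val < m then α else β

/-- The normalized sum of the entries in the first block. -/
noncomputable def headMean {N : ℕ} (m : ℕ) (x : Fin N → ℝ) : ℝ :=
  (N : ℝ)⁻¹ * ∑ i, if i.val < m then x i else 0

/-- The normalized sum of the entries outside the first block. -/
noncomputable def tailMean {N : ℕ} (m : ℕ) (x : Fin N → ℝ) : ℝ :=
  (N : ℝ)⁻¹ * ∑ i, if i.val < m then 0 else x i

theorem normVar_mulVec (k m : ℕ) (x : Fin (k * m) → ℝ) :
    normVar (blockProfile k m) *ᵥ x = blockVec (k * m) m (tailMean m x) (headMean m x) := by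
  ext i
  simp only [Matrix.mulVec, dotProduct, normVar, blockProfile, blockVec, headMean, tailMean,
    Matrix.smul_apply, Matrix.hadamard_apply, Matrix.of_apply, smul_eq_mul, mul_assoc,
    ← Finset.mul_sum]
  by_cases h : i.val < m
  · simp only [h, if_true]
    congr 1
    refine Finset.sum_congr rfl fun j _ => ?_
    by_cases hj : j.val < m <;> simp [hj]
  · simp only [h, if_false]
    congr 1
    refine Finset.sum_congr rfl fun j _ => ?_
    by_cases hj : j.val < m <;> simp [hj]

theorem normVar_transpose (k m : ℕ) :
    (normVar (blockProfile k m))ᵀ = normVar (blockProfile k m) := by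
  ext i j
  simp only [normVar, blockProfile, Matrix.transpose_apply, Matrix.smul_apply,
    Matrix.hadamard_apply, Matrix.of_apply]
  by_cases h : i.val < m <;> by_cases hj : j.val < m <;> simp [h, hj]

theorem headMean_add_tailMean {N : ℕ} (m : ℕ) (x : Fin N → ℝ) :
    headMean m x + tailMean m x = (N : ℝ)⁻¹ * ∑ i, x i := by
  rw [headMean, tailMean, ← mul_add, ← Finset.sum_add_distrib]
  congr 1
  refine Finset.sum_congr rfl fun j _ => ?_
  by_cases hj : j.val < m <;> simp [hj]

theorem sum_head {k m : ℕ} (hk : 1 ≤ k) (α : ℝ) :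
    (∑ i : Fin (k * m), if i.val < m then α else 0) = m * α := by
  rw [Fin.sum_univ_eq_sum_range (fun i => if i < m then α else 0) (k * m), ← Finset.sum_filter]
  have : (Finset.range (k * m)).filter (· < m) = Finset.range m := by
    ext i
    simp only [Finset.mem_filter, Finset.mem_range]
    have := Nat.le_mul_of_pos_left m hk
    omega
  rw [this]
  simp

theorem headMean_blockVec {k m : ℕ} (hk : 1 ≤ k) (hm : 1 ≤ m) (α β : ℝ) :
    headMean m (blockVec (k * m) m α β) = α / k := by
  have h : headMean m (blockVec (k * m) m α β) =
      ((k * m : ℕ) : ℝ)⁻¹ * ∑ i : Fin (k * m), if i.val < m then α else 0 := by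
    rw [headMean]
    congr 1
    refine Finset.sum_congr rfl fun j _ => ?_
    by_cases hj : j.val < m <;> simp [hj, blockVec]
  rw [h, sum_head hk]
  have : (k : ℝ) ≠ 0 := by positivity
  have : (m : ℝ) ≠ 0 := by positivity
  push_cast
  field_simp

theorem tailMean_blockVec {k m : ℕ} (hk : 1 ≤ k) (hm : 1 ≤ m) (α β : ℝ) :
    tailMean m (blockVec (k * m) m α β) = (k - 1) / k * β := by
  -- The tail does not see the first value, so the vector may be taken constant; the tail is then
  -- the total mean minus the head.
  have h1 : tailMean m (blockVec (k * m) m α β) = tailMean m (blockVec (k * m) m β β) := by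
    rw [tailMean, tailMean]
    congr 1
    refine Finset.sum_congr rfl fun j _ => ?_
    by_cases hj : j.val < m <;> simp [hj, blockVec]
  have h2 := headMean_add_tailMean m (blockVec (k * m) m β β)
  rw [headMean_blockVec hk hm] at h2
  have : (k : ℝ) ≠ 0 := by positivity
  have : (m : ℝ) ≠ 0 := by positivity
  simp only [blockVec, ite_self, Finset.sum_const, Finset.card_univ, Fintype.card_fin,
    nsmul_eq_mul] at h2
  rw [h1, eq_sub_of_add_eq' h2]
  push_cast
  field_simp

theorem smul_blockVec (N m : ℕ) (c α β : ℝ) :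
    c • blockVec N m α β = blockVec N m (c * α) (c * β) := by
  ext i
  by_cases h : i.val < m <;> simp [blockVec, h]

theorem normVar_mulVec_blockVec {k m : ℕ} (hk : 1 ≤ k) (hm : 1 ≤ m) (α β : ℝ) :
    normVar (blockProfile k m) *ᵥ blockVec (k * m) m α β =
      blockVec (k * m) m ((k - 1) / k * β) (α / k) := by
  rw [normVar_mulVec, headMean_blockVec hk hm, tailMean_blockVec hk hm]

theorem headMean_nonneg {N : ℕ} (m : ℕ) {x : Fin N → ℝ} (hx : ∀ i, 0 ≤ x i) :
    0 ≤ headMean m x := by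
  refine mul_nonneg (by positivity) (Finset.sum_nonneg fun i _ => ?_)
  split_ifs
  exacts [hx i, le_rfl]

theorem tailMean_nonneg {N : ℕ} (m : ℕ) {x : Fin N → ℝ} (hx : ∀ i, 0 ≤ x i) :
    0 ≤ tailMean m x := by
  refine mul_nonneg (by positivity) (Finset.sum_nonneg fun i _ => ?_)
  split_ifs
  exacts [le_rfl, hx i]

/-! ### The spectral radius -/

/-- On block-constant vectors `V` swaps the two values with weights `(k-1)/k` and `1/k`, so `V²`
multiplies the range of `V` by the product of the weights. Eigenvalues are thereby confined to `0`
and `±ρ`. -/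
theorem normVar_cube {k m : ℕ} (hk : 1 ≤ k) (hm : 1 ≤ m) :
    normVar (blockProfile k m) * normVar (blockProfile k m) * normVar (blockProfile k m) =
      (((k : ℝ) - 1) / k ^ 2) • normVar (blockProfile k m) := by
  refine Matrix.ext_of_mulVec_single fun i => ?_
  rw [Matrix.smul_mulVec, ← Matrix.mulVec_mulVec, ← Matrix.mulVec_mulVec,
    normVar_mulVec k m (Pi.single i 1), normVar_mulVec_blockVec hk hm,
    normVar_mulVec_blockVec hk hm, smul_blockVec]
  have : (k : ℝ) ≠ 0 := by positivity
  congr 1 <;> field_simp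

theorem specRad_blockProfile {k m : ℕ} (hk : 1 ≤ k) (hm : 1 ≤ m) :
    specRad (normVar (blockProfile k m)) = √((k : ℝ) - 1) / k := by
  have hk0 : (0 : ℝ) < k := by positivity
  have hk1 : (0 : ℝ) ≤ (k : ℝ) - 1 := by
    have : (1 : ℝ) ≤ k := by exact_mod_cast hk
    linarith
  set ρ : ℝ := √((k : ℝ) - 1) / k with hρ
  have hρ0 : 0 ≤ ρ := by positivity
  have hρ2 : ρ ^ 2 = ((k : ℝ) - 1) / k ^ 2 := by
    rw [hρ, div_pow, Real.sq_sqrt hk1]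
  set W : Matrix (Fin (k * m)) (Fin (k * m)) ℂ :=
    (normVar (blockProfile k m)).map Complex.ofReal with hW
  have hcube : W * W * W = ((ρ ^ 2 : ℝ) : ℂ) • W := by
    have h := congrArg (fun M => M.map (Complex.ofRealHom : ℝ →+* ℂ)) (normVar_cube hk hm)
    simp only [Matrix.map_mul] at h
    rw [hρ2]
    refine h.trans ?_
    ext i j
    simp [hW]
  have hmem : ∀ l : ℂ, l ∈ spectrum ℂ W ↔ ∃ v, v ≠ 0 ∧ W *ᵥ v = l • v := by
    intro l
    rw [← Matrix.spectrum_toLin', ← Module.End.hasEigenvalue_iff_mem_spectrum]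
    constructor
    · intro h
      obtain ⟨v, hv⟩ := h.exists_hasEigenvector
      exact ⟨v, hv.2, by simpa using hv.apply_eq_smul⟩
    · rintro ⟨v, hv, h⟩
      exact Module.End.hasEigenvalue_of_hasEigenvector
        (x := v) ⟨Module.End.mem_eigenspace_iff.2 (by simpa using h), hv⟩
  have hle : ∀ l ∈ spectrum ℂ W, ‖l‖ ≤ ρ := by
    intro l hl
    obtain ⟨v, hv, h⟩ := (hmem l).1 hl
    have h3 : (l ^ 3) • v = (((ρ ^ 2 : ℝ) : ℂ) * l) • v := by
      have := congrArg (fun M => M *ᵥ v) hcube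
      simp only [Matrix.smul_mulVec, ← Matrix.mulVec_mulVec, h, Matrix.mulVec_smul, smul_smul] at this
      rw [← this]
      congr 1
      ring
    have h4 : l ^ 3 = ((ρ ^ 2 : ℝ) : ℂ) * l := smul_left_injective ℂ hv h3
    by_cases hl0 : l = 0
    · simpa [hl0] using hρ0
    have h5 : l ^ 2 = ((ρ ^ 2 : ℝ) : ℂ) := by
      apply mul_right_cancel₀ hl0
      rw [← h4]
      ring
    have h6 : ‖l‖ ^ 2 = ρ ^ 2 := by
      rw [← norm_pow, h5, Complex.norm_real, Real.norm_of_nonneg (by positivity)]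
    exact (pow_le_pow_iff_left₀ (norm_nonneg l) hρ0 two_ne_zero).1 h6.le
  have key : spectralRadius ℂ W = ENNReal.ofReal ρ := by
    apply le_antisymm
    · refine iSup₂_le fun l hl => ?_
      rw [← enorm_eq_nnnorm, ← ofReal_norm]
      exact ENNReal.ofReal_le_ofReal (hle l hl)
    -- The case `ρ = 0` is `k = 1`. Otherwise the block vector `(√(k-1), 1)` is an eigenvector for
    -- `ρ`.
    · rcases hρ0.eq_or_lt with h0 | h0
      · simp [← h0]
      · have hin : ((ρ : ℝ) : ℂ) ∈ spectrum ℂ W := by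
          rw [hmem]
          have hsq := Real.sq_sqrt hk1
          have hv : normVar (blockProfile k m) *ᵥ blockVec (k * m) m (√((k : ℝ) - 1)) 1 =
              ρ • blockVec (k * m) m (√((k : ℝ) - 1)) 1 := by
            rw [normVar_mulVec_blockVec hk hm, smul_blockVec]
            congr 1
            · rw [hρ]
              field_simp
              linarith
            · rw [hρ]
              ring
          refine ⟨fun i => (blockVec (k * m) m (√((k : ℝ) - 1)) 1 i : ℂ), ?_, ?_⟩
          · intro h
            have hs : √((k : ℝ) - 1) ≠ 0 := fun h => by simp [hρ, h] at h0
            have := congrFun h ⟨0, by positivity⟩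
            simp [blockVec, show 0 < m from hm] at this
            exact hs this
          · ext i
            have := congrArg (Complex.ofReal) (congrFun hv i)
            simpa [Matrix.mulVec, dotProduct, hW] using this
        refine le_trans ?_ (le_iSup₂ (f := fun l (_ : l ∈ spectrum ℂ W) => (‖l‖₊ : ENNReal)) _ hin)
        rw [← enorm_eq_nnnorm, ← ofReal_norm, Complex.norm_real, Real.norm_of_nonneg hρ0]
  rw [specRad, ← hW, key, ENNReal.toReal_ofReal hρ0]

theorem sqrt_specRad_blockProfile {k m : ℕ} (hk : 1 ≤ k) (hm : 1 ≤ m) :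
    √(specRad (normVar (blockProfile k m))) = rhoStar k := by
  have hk1 : (0 : ℝ) ≤ (k : ℝ) - 1 := by
    have : (1 : ℝ) ≤ k := by exact_mod_cast hk
    linarith
  rw [specRad_blockProfile hk hm, rhoStar, Real.sqrt_div (Real.sqrt_nonneg _),
    Real.sqrt_eq_rpow (√((k : ℝ) - 1)), Real.sqrt_eq_rpow ((k : ℝ) - 1), ← Real.rpow_mul hk1]
  norm_num

theorem rhoStar_nonneg {k : ℕ} (hk : 1 ≤ k) : 0 ≤ rhoStar k := by
  -- `ρ*` does not involve `m`, so the case `m = 1` suffices.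
  rw [← sqrt_specRad_blockProfile hk le_rfl]
  positivity

theorem rhoStar_pow_four {k : ℕ} (hk : 1 ≤ k) : rhoStar k ^ 4 = ((k : ℝ) - 1) / k ^ 2 := by
  have hk1 : (0 : ℝ) ≤ (k : ℝ) - 1 := by
    have : (1 : ℝ) ≤ k := by exact_mod_cast hk
    linarith
  rw [← sqrt_specRad_blockProfile hk le_rfl, specRad_blockProfile hk le_rfl,
    show 4 = 2 * 2 from rfl, pow_mul, Real.sq_sqrt (by positivity), div_pow, Real.sq_sqrt hk1]

theorem rhoStar_pos {k : ℕ} (hk : 2 ≤ k) : 0 < rhoStar k := by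
  have h2 : (2 : ℝ) ≤ k := by exact_mod_cast hk
  refine (rhoStar_nonneg (by omega)).lt_of_ne fun h => ?_
  have h4 := rhoStar_pow_four (k := k) (by omega)
  have : 0 < ((k : ℝ) - 1) / k ^ 2 := div_pos (by linarith) (by positivity)
  rw [← h4, ← h] at this
  norm_num at this

theorem boundedVariances_blockProfile (k : ℕ) :
    BoundedVariances (fun m : ℕ+ => blockProfile k (m : ℕ)) := by
  refine ⟨1, one_pos, fun i a b => ?_⟩
  simp only [blockProfile, Matrix.of_apply]
  split_ifs <;> norm_num

end VarianceProfile

/-! ### Regularized Master Equations and admissibility -/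

namespace VarianceProfile

/-- AM–GM. This supplies both the admissibility constant and the upper end of the bracket for the
intermediate value theorem. -/
theorem div_sq_add_sq_le {s : ℝ} (hs : 0 < s) (u : ℝ) : u / (s ^ 2 + u ^ 2) ≤ 1 / (2 * s) := by
  rw [div_le_div_iff₀ (by positivity) (by positivity)]
  nlinarith [sq_nonneg (s - u)]

/-- Cauchy–Schwarz for the vectors `(s, u)` and `(s, -v)`. -/
theorem sq_sub_mul_le (s u v : ℝ) :
    (s ^ 2 - u * v) ^ 2 ≤ (s ^ 2 + u ^ 2) * (s ^ 2 + v ^ 2) := by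
  nlinarith [sq_nonneg (s * (u + v))]

/-- At a positive solution of the scalar regularized system, the product of the denominators is
bounded below. -/
theorem lt_mul_of_regularized {κ c t p u D E : ℝ} (hκ : 0 < κ) (hc : 0 ≤ c) (ht : 0 < t)
    (hp : 0 < p) (hD : 0 < D) (hE : 0 < E)
    (h1 : p = u / D / κ + t) (h2 : u = c * (p / E) + t) : c < κ * D * E := by
  have h3 : κ * D * p = u + κ * D * t := by
    rw [h1]; field_simp
  have h4 : E * u = c * p + E * t := by
    rw [h2]; field_simp
  have h5 : 0 < κ * D * t := by positivity
  have h6 : 0 < E * t := by positivity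
  -- Eliminating `u` gives `κDEp = cp` plus terms that are strictly positive because `t > 0`.
  have h7 : c * p < κ * D * E * p := by
    nlinarith [mul_pos hE h5]
  exact lt_of_mul_lt_mul_right h7 hp.le

/-- The two components of a positive solution of the scalar regularized system agree. -/
theorem regularized_eq {κ c t p p' u u' D E : ℝ} (hκ : 0 < κ) (hc : 0 ≤ c) (ht : 0 < t)
    (hp : 0 < p) (hD : 0 < D) (hE : 0 < E)
    (h1 : p = u / D / κ + t) (h2 : u = c * (p / E) + t)
    (h1' : p' = u' / D / κ + t) (h2' : u' = c * (p' / E) + t) : p = p' ∧ u = u' := by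
  have hlt := lt_mul_of_regularized hκ hc ht hp hD hE h1 h2
  have h3 : κ * D * (p - p') = u - u' := by
    rw [h1, h1']; field_simp; ring
  have h4 : E * (u - u') = c * (p - p') := by
    rw [h2, h2']; field_simp; ring
  -- The difference of the solutions lies in the kernel of a 2×2 system with determinant `κDE - c >
  -- 0`.
  have h5 : (κ * D * E - c) * (p - p') = 0 := by
    linear_combination E * h3 + h4
  have h6 : p - p' = 0 := (mul_eq_zero.1 h5).resolve_left (by linarith)
  refine ⟨by linarith, ?_⟩
  rw [h6] at h3
  linarith

/-- Two distinct solutions would satisfy `κ² DD'EE' ≤ c²`, by multiplying the two difference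
equations and applying `sq_sub_mul_le`; but `lt_mul_of_regularized` at each solution gives `c² < κ²
DD'EE'`. -/
theorem regularized_scalar_unique {κ c s t p p' u u' : ℝ} (hκ : 0 < κ) (hc : 0 ≤ c) (hs : 0 < s)
    (ht : 0 < t) (hp : 0 < p) (hp' : 0 < p')
    (h1 : p = u / (s ^ 2 + u ^ 2) / κ + t) (h2 : u = c * (p / (s ^ 2 + p ^ 2)) + t)
    (h1' : p' = u' / (s ^ 2 + u' ^ 2) / κ + t) (h2' : u' = c * (p' / (s ^ 2 + p' ^ 2)) + t) :
    p = p' ∧ u = u' := by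
  have hlt := lt_mul_of_regularized hκ hc ht hp (by positivity) (by positivity) h1 h2
  have hlt' := lt_mul_of_regularized hκ hc ht hp' (by positivity) (by positivity) h1' h2'
  have hu := sq_sub_mul_le s u u'
  have hpp := sq_sub_mul_le s p p'
  set D := s ^ 2 + u ^ 2 with hD
  set D' := s ^ 2 + u' ^ 2 with hD'
  set E := s ^ 2 + p ^ 2 with hE
  set E' := s ^ 2 + p' ^ 2 with hE'
  have hD0 : 0 < D := by positivity
  have hD0' : 0 < D' := by positivity
  have hE0 : 0 < E := by positivity
  have hE0' : 0 < E' := by positivity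
  have e1 : κ * (D * D') * (p - p') = (u - u') * (s ^ 2 - u * u') := by
    rw [h1, h1']; field_simp; rw [hD, hD']; ring
  have e2 : (E * E') * (u - u') = c * (p - p') * (s ^ 2 - p * p') := by
    rw [h2, h2']; field_simp; rw [hE, hE']; ring
  by_cases hpe : p = p'
  · refine ⟨hpe, ?_⟩
    rw [h2, h2', hE, hE', hpe]
  exfalso
  have hne : p - p' ≠ 0 := sub_ne_zero.2 hpe
  set a := s ^ 2 - u * u'
  set b := s ^ 2 - p * p'
  have e3 : κ * (D * D') * (E * E') = c * (a * b) := by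
    apply mul_right_cancel₀ hne
    linear_combination (E * E') * e1 + a * e2
  have e4 : (a * b) ^ 2 ≤ (D * D') * (E * E') := by
    rw [mul_pow]
    exact mul_le_mul hu hpp (sq_nonneg _) (by positivity)
  have hQ : 0 < (D * D') * (E * E') := by positivity
  have e5 : (κ * (D * D') * (E * E')) ^ 2 ≤ c ^ 2 * ((D * D') * (E * E')) := by
    rw [e3, mul_pow]
    exact mul_le_mul_of_nonneg_left e4 (sq_nonneg _)
  have e6 : κ ^ 2 * ((D * D') * (E * E')) ≤ c ^ 2 := by
    refine le_of_mul_le_mul_right ?_ hQ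
    linarith
  have e7 : c * c < (κ * D * E) * (κ * D' * E') := mul_lt_mul'' hlt hlt' hc hc
  linarith

theorem regularized_scalar_exists {κ c s t : ℝ} (hκ : 0 < κ) (hc : 0 ≤ c) (hs : 0 < s)
    (ht : 0 < t) : ∃ p u : ℝ, 0 < p ∧ 0 < u ∧
      p = u / (s ^ 2 + u ^ 2) / κ + t ∧ u = c * (p / (s ^ 2 + p ^ 2)) + t := by
  set U : ℝ → ℝ := fun p => c * (p / (s ^ 2 + p ^ 2)) + t with hU
  set g : ℝ → ℝ := fun p => U p / (s ^ 2 + U p ^ 2) / κ + t - p with hg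
  have hUc : Continuous U := by
    have : ∀ p : ℝ, s ^ 2 + p ^ 2 ≠ 0 := fun p => by positivity
    fun_prop (disch := assumption)
  have hgc : Continuous g := by
    have : ∀ p : ℝ, s ^ 2 + U p ^ 2 ≠ 0 := fun p => by positivity
    fun_prop (disch := assumption)
  have hU0 : ∀ p, 0 ≤ p → 0 < U p := fun p hp => by positivity
  -- Every value of `u / (s² + u²) / κ + t` is at most `b`, so `g b ≤ 0`.
  set b := 1 / (2 * s) / κ + t with hb
  have hb0 : t ≤ b := by
    rw [hb]; have : 0 < 1 / (2 * s) / κ := by positivity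
    linarith
  have hgt : 0 ≤ g t := by
    have := hU0 t ht.le
    simp only [hg, add_sub_cancel_right]
    positivity
  have hgb : g b ≤ 0 := by
    have := div_le_div_of_nonneg_right (div_sq_add_sq_le hs (U b)) hκ.le
    simp only [hg]
    linarith
  obtain ⟨p, hp, hp0⟩ := intermediate_value_Icc' hb0 hgc.continuousOn (show (0 : ℝ) ∈ _ from ⟨hgb, hgt⟩)
  have hpp : 0 < p := ht.trans_le hp.1
  refine ⟨p, U p, hpp, hU0 p hpp.le, ?_, rfl⟩
  simp only [hg] at hp0
  linarith

theorem IsRegularizedSolution.exists_scalar {k m : ℕ} (hk : 1 ≤ k) (hm : 1 ≤ m) {s t : ℝ}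
    (hs : 0 < s) (ht : 0 < t) {r : (Fin (k * m) → ℝ) × (Fin (k * m) → ℝ)}
    (h : IsRegularizedSolution (normVar (blockProfile k m)) s t r) :
    ∃ p u : ℝ, 0 < p ∧ p = u / (s ^ 2 + u ^ 2) / k + t ∧
      u = (k - 1) / k * (p / (s ^ 2 + p ^ 2)) + t ∧
      r.1 = blockVec (k * m) m (u / (s ^ 2 + u ^ 2)) (p / (s ^ 2 + p ^ 2)) ∧ r.2 = r.1 := by
  obtain ⟨hp1, hp2, he1, he2⟩ := h
  rw [normVar_transpose, normVar_mulVec, normVar_mulVec] at he1 he2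
  have hx := headMean_nonneg m fun i => (hp1 i).le
  have hy := tailMean_nonneg m fun i => (hp1 i).le
  have hx' := headMean_nonneg m fun i => (hp2 i).le
  have hy' := tailMean_nonneg m fun i => (hp2 i).le
  have hk1 : (0 : ℝ) ≤ ((k : ℝ) - 1) / k := by
    have : (1 : ℝ) ≤ k := by exact_mod_cast hk
    exact div_nonneg (by linarith) (by positivity)
  set x := headMean m r.1 with hxd
  set y := tailMean m r.1 with hyd
  set x' := headMean m r.2 with hxd'
  set y' := tailMean m r.2 with hyd'
  have hr1 : r.1 = blockVec (k * m) m ((y + t) / (s ^ 2 + (y' + t) * (y + t)))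
      ((x + t) / (s ^ 2 + (x' + t) * (x + t))) := by
    ext i
    rw [he1 i]
    by_cases hi : i.val < m <;> simp [blockVec, hi]
  have hr2 : r.2 = blockVec (k * m) m ((y' + t) / (s ^ 2 + (y' + t) * (y + t)))
      ((x' + t) / (s ^ 2 + (x' + t) * (x + t))) := by
    ext i
    rw [he2 i]
    by_cases hi : i.val < m <;> simp [blockVec, hi]
  have hX : x = _ := (congrArg (headMean m) hr1).trans (headMean_blockVec hk hm _ _)
  have hY : y = _ := (congrArg (tailMean m) hr1).trans (tailMean_blockVec hk hm _ _)
  have hX' : x' = _ := (congrArg (headMean m) hr2).trans (headMean_blockVec hk hm _ _)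
  have hY' : y' = _ := (congrArg (tailMean m) hr2).trans (tailMean_blockVec hk hm _ _)
  have hκ : (0 : ℝ) < k := by positivity
  -- The denominators `D` and `E` are common to `r` and `r̃`; with them frozen, both pairs of
  -- shifted means solve the same linear system.
  obtain ⟨hxx, hyy⟩ := regularized_eq (p := x + t) (p' := x' + t) (u := y + t) (u' := y' + t)
    (D := s ^ 2 + (y' + t) * (y + t)) (E := s ^ 2 + (x' + t) * (x + t)) hκ hk1 ht (by positivity)
    (by positivity) (by positivity) (by linarith) (by linarith) (by linarith) (by linarith)
  rw [← hxx, ← hyy, ← sq, ← sq] at hr1 hr2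
  rw [← hyy, ← sq] at hX
  rw [← hxx, ← sq] at hY
  exact ⟨x + t, y + t, by positivity, by linarith, by linarith, hr1, hr2.trans hr1.symm⟩

theorem isRegularizedSolution_of_scalar {k m : ℕ} (hk : 1 ≤ k) (hm : 1 ≤ m) {s t p u : ℝ}
    (hs : 0 < s) (hp : 0 < p) (hu : 0 < u) (h1 : p = u / (s ^ 2 + u ^ 2) / k + t)
    (h2 : u = (k - 1) / k * (p / (s ^ 2 + p ^ 2)) + t) :
    IsRegularizedSolution (normVar (blockProfile k m)) s t
      (blockVec (k * m) m (u / (s ^ 2 + u ^ 2)) (p / (s ^ 2 + p ^ 2)),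
        blockVec (k * m) m (u / (s ^ 2 + u ^ 2)) (p / (s ^ 2 + p ^ 2))) := by
  have hpos : ∀ i, 0 < blockVec (k * m) m (u / (s ^ 2 + u ^ 2)) (p / (s ^ 2 + p ^ 2)) i := by
    intro i
    simp only [blockVec]
    split_ifs <;> positivity
  have heq : ∀ i, blockVec (k * m) m (u / (s ^ 2 + u ^ 2)) (p / (s ^ 2 + p ^ 2)) i =
      (blockVec (k * m) m u p i) / (s ^ 2 + blockVec (k * m) m u p i * blockVec (k * m) m u p i) := by
    intro i
    by_cases hi : i.val < m <;> simp [blockVec, hi, sq]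
  have hV : ∀ i, blockVec (k * m) m ((k - 1) / k * (p / (s ^ 2 + p ^ 2)))
      (u / (s ^ 2 + u ^ 2) / k) i + t = blockVec (k * m) m u p i := by
    intro i
    simp only [blockVec]
    split_ifs
    exacts [h2.symm, h1.symm]
  constructor
  · exact hpos
  · exact hpos
  all_goals
    intro i
    simp only [normVar_transpose, normVar_mulVec_blockVec hk hm]
    rw [hV i]
    exact heq i

theorem admissible_blockProfile {k : ℕ} (hk : 1 ≤ k) :
    Admissible (fun m : ℕ+ => blockProfile k (m : ℕ)) := by
  intro s hs
  have hκ : (0 : ℝ) < k := by positivity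
  have hk1 : (0 : ℝ) ≤ ((k : ℝ) - 1) / k := by
    have : (1 : ℝ) ≤ k := by exact_mod_cast hk
    exact div_nonneg (by linarith) (by positivity)
  refine ⟨1 / (2 * s), by positivity, fun m t ht _ => ⟨?_, ?_⟩⟩
  · obtain ⟨p, u, hp, hu, h1, h2⟩ := regularized_scalar_exists hκ hk1 hs ht
    refine ⟨_, isRegularizedSolution_of_scalar hk m.pos hs hp hu h1 h2, fun r hr => ?_⟩
    obtain ⟨p', u', hp', h1', h2', hr1, hr2⟩ := hr.exists_scalar hk m.pos hs ht
    obtain ⟨rfl, rfl⟩ := regularized_scalar_unique hκ hk1 hs ht hp hp' h1 h2 h1' h2'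
    exact Prod.ext hr1 (hr2.trans hr1)
  · intro r hr
    obtain ⟨p, u, hp, h1, h2, hr1, hr2⟩ := hr.exists_scalar hk m.pos hs ht
    have hle : ∀ i, r.1 i ≤ 1 / (2 * s) := by
      intro i
      rw [hr1]
      simp only [blockVec]
      split_ifs <;> exact div_sq_add_sq_le hs _
    have hn : (0 : ℝ) < ((k * (m : ℕ) : ℕ) : ℝ) := by
      have := m.pos
      positivity
    have := Finset.sum_le_sum fun i (_ : i ∈ Finset.univ) => hle i
    simp only [Finset.sum_const, Finset.card_univ, Fintype.card_fin, nsmul_eq_mul] at this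
    rw [one_div_mul_eq_div, div_le_iff₀ hn]
    linarith

end VarianceProfile

/-! ### Master Equations and the closed form of `F` -/

namespace VarianceProfile

/-- The closed form of `F_∞` on `[0, ρ*]`. -/
noncomputable def profileF (k : ℕ) (s : ℝ) : ℝ :=
  1 / (k : ℝ) * √(((k : ℝ) - 2) ^ 2 + 4 * k ^ 2 * s ^ 4)

/-- The product `x y` of the block means of the nontrivial solution of the Master Equations. -/
noncomputable def masterW (k : ℕ) (s : ℝ) : ℝ := (1 - profileF k s) / 2

theorem profileF_nonneg (k : ℕ) (s : ℝ) : 0 ≤ profileF k s := by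
  unfold profileF; positivity

theorem profileF_sq {k : ℕ} (hk : 1 ≤ k) (s : ℝ) :
    profileF k s ^ 2 = 1 - 4 * (((k : ℝ) - 1) / k ^ 2 - s ^ 4) := by
  have : (k : ℝ) ≠ 0 := by positivity
  rw [profileF, mul_pow, Real.sq_sqrt (by positivity)]
  field_simp
  ring

theorem profileF_zero {k : ℕ} (hk : 2 ≤ k) : profileF k 0 = 1 - 2 / (k : ℝ) := by
  have h2 : (2 : ℝ) ≤ k := by exact_mod_cast hk
  have : (k : ℝ) ≠ 0 := by positivity
  rw [profileF]
  norm_num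
  rw [Real.sqrt_sq (by linarith)]
  field_simp

theorem profileF_rhoStar {k : ℕ} (hk : 1 ≤ k) : profileF k (rhoStar k) = 1 := by
  have h := profileF_sq hk (rhoStar k)
  rw [rhoStar_pow_four hk, sub_self, mul_zero, sub_zero] at h
  exact (pow_eq_one_iff_of_nonneg (profileF_nonneg k _) two_ne_zero).1 h

theorem continuous_profileF (k : ℕ) : Continuous (profileF k) := by
  unfold profileF; fun_prop

theorem profileF_lt_one {k : ℕ} (hk : 1 ≤ k) {s : ℝ} (hs : 0 ≤ s) (h : s < rhoStar k) :
    profileF k s < 1 := by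
  have h4 : s ^ 4 < rhoStar k ^ 4 := pow_lt_pow_left₀ h hs (by norm_num)
  rw [rhoStar_pow_four hk] at h4
  have := profileF_sq hk s
  nlinarith [profileF_nonneg k s]

/-- By `profileF_sq`, `w - w² = (1 - F²)/4 = (k-1)/k² - s⁴`. -/
theorem masterW_spec {k : ℕ} (hk : 1 ≤ k) (s : ℝ) :
    s ^ 4 = (1 / k - masterW k s) * ((k - 1) / k - masterW k s) := by
  have h := profileF_sq hk s
  have : (k : ℝ) ≠ 0 := by positivity
  have h2 : ((1 : ℝ) / k - masterW k s) * ((k - 1) / k - masterW k s) =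
      (k - 1) / k ^ 2 - masterW k s + masterW k s ^ 2 := by
    field_simp
    ring
  rw [h2, masterW]
  linarith

/-- Identifies `masterW` as the smaller root: `F(s) > F(0) = 1 - 2/k`, where `k ≥ 2` removes the
absolute value in `√((k-2)²)`. -/
theorem masterW_lt {k : ℕ} (hk : 2 ≤ k) {s : ℝ} (hs : 0 < s) : masterW k s < 1 / k := by
  have h2 : (2 : ℝ) ≤ k := by exact_mod_cast hk
  have hk0 : (0 : ℝ) < k := by positivity
  have h0 := profileF_zero hk
  have : profileF k 0 < profileF k s := by
    unfold profileF
    refine mul_lt_mul_of_pos_left (Real.sqrt_lt_sqrt (by positivity) ?_) (by positivity)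
    have : 0 < 4 * (k : ℝ) ^ 2 * s ^ 4 := by positivity
    simpa using this
  rw [masterW]
  have e : (2 : ℝ) / k = 2 * (1 / k) := by ring
  linarith

/-- The scalar form of the Master Equations determines the product of the two unknowns, and then
the unknowns themselves. -/
theorem master_scalar {k : ℕ} (hk : 2 ≤ k) {s x y : ℝ} (hs : 0 < s) (hx : 0 < x) (hy : 0 < y)
    (h1 : x = y / (s ^ 2 + y ^ 2) / k) (h2 : y = (k - 1) / k * (x / (s ^ 2 + x ^ 2))) :
    x * y = masterW k s ∧ x ^ 2 = (masterW k s / k - masterW k s ^ 2) / s ^ 2 ∧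
      y ^ 2 = ((k - 1) / k * masterW k s - masterW k s ^ 2) / s ^ 2 := by
  have h2k : (2 : ℝ) ≤ k := by exact_mod_cast hk
  have hk0 : (0 : ℝ) < k := by positivity
  have e1 : x * (s ^ 2 + y ^ 2) = y * (1 / k) := by
    nth_rewrite 1 [h1]
    field_simp
  have e2 : y * (s ^ 2 + x ^ 2) = (k - 1) / k * x := by
    nth_rewrite 1 [h2]
    field_simp
  set w := x * y with hw
  have hw0 : 0 < w := mul_pos hx hy
  have e3 : x ^ 2 * s ^ 2 = w * (1 / k - w) := by
    rw [hw]; linear_combination x * e1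
  have e4 : y ^ 2 * s ^ 2 = w * ((k - 1) / k - w) := by
    rw [hw]; linear_combination y * e2
  have hwk : w < 1 / k := by
    have : 0 < w * (1 / k - w) := by rw [← e3]; positivity
    have := pos_of_mul_pos_right this hw0.le
    linarith
  have e5 : s ^ 4 = (1 / k - w) * ((k - 1) / k - w) := by
    have : w ^ 2 * s ^ 4 = w ^ 2 * ((1 / k - w) * ((k - 1) / k - w)) := by
      calc w ^ 2 * s ^ 4 = (x ^ 2 * s ^ 2) * (y ^ 2 * s ^ 2) := by rw [hw]; ring
        _ = _ := by rw [e3, e4]; ring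
    exact mul_left_cancel₀ (by positivity) this
  have hww : w = masterW k s := by
    have e6 := masterW_spec (by omega : 1 ≤ k) s
    have hlt := masterW_lt hk hs
    have hsum : (1 : ℝ) / k + (k - 1) / k = 1 := by field_simp; ring
    have hhalf : (1 : ℝ) / k ≤ 1 / 2 := one_div_le_one_div_of_le two_pos h2k
    -- Two roots of the same quadratic coincide or add up to 1; the latter fails since both are
    -- below `1/k ≤ 1/2`.
    have h0 : (w - masterW k s) * (w + masterW k s - (1 / k + (k - 1) / k)) = 0 := by
      linear_combination e6 - e5
    rw [hsum] at h0
    have := (mul_eq_zero.1 h0).resolve_right (by linarith)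
    linarith
  rw [← hww]
  refine ⟨rfl, ?_, ?_⟩
  · rw [eq_div_iff (by positivity), e3]; ring
  · rw [eq_div_iff (by positivity), e4]; ring

/-- The formulas of `master_scalar` for the squares are taken as definitions. They are positive
because `0 < w < 1/k`, and the quadratic for `w` gives `XY = w²`. -/
theorem master_scalar_exists {k : ℕ} (hk : 2 ≤ k) {s : ℝ} (hs : 0 < s) (h : s < rhoStar k) :
    ∃ x y : ℝ, 0 < x ∧ 0 < y ∧ x = y / (s ^ 2 + y ^ 2) / k ∧
      y = (k - 1) / k * (x / (s ^ 2 + x ^ 2)) := by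
  have h2k : (2 : ℝ) ≤ k := by exact_mod_cast hk
  have hk0 : (0 : ℝ) < k := by positivity
  have hlt := masterW_lt hk hs
  have hpos : 0 < masterW k s := by
    have := profileF_lt_one (by omega : 1 ≤ k) hs.le h
    rw [masterW]; linarith
  have hspec := masterW_spec (by omega : 1 ≤ k) s
  set w := masterW k s
  have hle : (1 : ℝ) / k ≤ (k - 1) / k := by gcongr; linarith
  set X := w * (1 / k - w) / s ^ 2 with hX
  set Y := w * ((k - 1) / k - w) / s ^ 2 with hY
  have hX0 : 0 < X := div_pos (mul_pos hpos (by linarith)) (by positivity)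
  have hY0 : 0 < Y := div_pos (mul_pos hpos (by linarith)) (by positivity)
  have hXY : X * Y = w ^ 2 := by
    rw [hX, hY, div_mul_div_comm, div_eq_iff (by positivity)]
    linear_combination -w ^ 2 * hspec
  have hxy : √X * √Y = w := by
    rw [← Real.sqrt_mul hX0.le, hXY, Real.sqrt_sq hpos.le]
  have hx := Real.sqrt_pos.2 hX0
  have hy := Real.sqrt_pos.2 hY0
  have hx2 := Real.sq_sqrt hX0.le
  have hy2 := Real.sq_sqrt hY0.le
  have eX : X * s ^ 2 = w * (1 / k - w) := by rw [hX]; field_simp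
  have eY : Y * s ^ 2 = w * ((k - 1) / k - w) := by rw [hY]; field_simp
  set x := √X
  set y := √Y
  refine ⟨x, y, hx, hy, ?_, ?_⟩
  · rw [div_div, eq_div_iff (by positivity)]
    apply mul_left_cancel₀ hx.ne'
    have : x ^ 2 * s ^ 2 = w * (1 / k - w) := by rw [hx2, eX]
    calc x * (x * ((s ^ 2 + y ^ 2) * k)) = (x ^ 2 * s ^ 2 + (x * y) ^ 2) * k := by ring
      _ = x * y := by rw [this, hxy]; field_simp; ring
  · rw [← mul_div_assoc, eq_div_iff (by positivity)]
    apply mul_left_cancel₀ hy.ne'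
    have : y ^ 2 * s ^ 2 = w * ((k - 1) / k - w) := by rw [hy2, eY]
    calc y * (y * (s ^ 2 + x ^ 2)) = (y ^ 2 * s ^ 2 + (x * y) ^ 2) := by ring
      _ = (k - 1) / k * (x * y) := by rw [this, hxy]; ring
      _ = _ := by ring

/-- Without the sum condition `(c q, c⁻¹ q̃)` would again be a solution for every `c > 0`, so the
determinant argument of the regularized case is not available; the sum condition removes this
freedom. -/
theorem IsMasterSolution.exists_scalar {k m : ℕ} (hk : 2 ≤ k) (hm : 1 ≤ m) {s : ℝ}
    (hs : 0 < s) {q : (Fin (k * m) → ℝ) × (Fin (k * m) → ℝ)} (hq : q ≠ 0)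
    (h : IsMasterSolution (normVar (blockProfile k m)) s q) :
    ∃ x y : ℝ, 0 < x ∧ 0 < y ∧ x = y / (s ^ 2 + y ^ 2) / k ∧
      y = (k - 1) / k * (x / (s ^ 2 + x ^ 2)) ∧
      q.1 = blockVec (k * m) m (y / (s ^ 2 + y ^ 2)) (x / (s ^ 2 + x ^ 2)) ∧ q.2 = q.1 := by
  have hk' : 1 ≤ k := by omega
  obtain ⟨hp1, hp2, he1, he2, hsum⟩ := h
  rw [normVar_transpose, normVar_mulVec, normVar_mulVec] at he1 he2
  have hx := headMean_nonneg m hp1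
  have hy := tailMean_nonneg m hp1
  have hx' := headMean_nonneg m hp2
  have hy' := tailMean_nonneg m hp2
  have hsum' : headMean m q.1 + tailMean m q.1 = headMean m q.2 + tailMean m q.2 := by
    rw [headMean_add_tailMean, headMean_add_tailMean, hsum]
  have hk0 : (0 : ℝ) < k := by positivity
  set x := headMean m q.1 with hxd
  set y := tailMean m q.1 with hyd
  set x' := headMean m q.2 with hxd'
  set y' := tailMean m q.2 with hyd'
  have hr1 : q.1 = blockVec (k * m) m (y / (s ^ 2 + y' * y)) (x / (s ^ 2 + x' * x)) := by
    ext i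
    rw [he1 i]
    by_cases hi : i.val < m <;> simp [blockVec, hi]
  have hr2 : q.2 = blockVec (k * m) m (y' / (s ^ 2 + y' * y)) (x' / (s ^ 2 + x' * x)) := by
    ext i
    rw [he2 i]
    by_cases hi : i.val < m <;> simp [blockVec, hi]
  have hX : x = _ := (congrArg (headMean m) hr1).trans (headMean_blockVec hk' hm _ _)
  have hY : y = _ := (congrArg (tailMean m) hr1).trans (tailMean_blockVec hk' hm _ _)
  have hX' : x' = _ := (congrArg (headMean m) hr2).trans (headMean_blockVec hk' hm _ _)
  set D := s ^ 2 + y' * y with hD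
  have hD0 : 0 < D := by positivity
  have e1 : y = k * D * x := by rw [hX]; field_simp
  have e1' : y' = k * D * x' := by rw [hX']; field_simp
  -- Each tail is the same multiple `kD` of its head, so equal totals give equal heads.
  have hxx : x = x' := by
    have h0 : (1 + k * D) * (x - x') = 0 := by linear_combination hsum' - e1 + e1'
    have := (mul_eq_zero.1 h0).resolve_left (by positivity)
    linarith
  have hyy : y = y' := by rw [e1, e1', hxx]
  rw [hD, ← hyy, ← sq] at hr1 hr2 hX
  rw [← hxx, ← sq] at hr1 hr2 hY
  have hx0 : 0 < x := by
    refine hx.lt_of_ne fun h0 => hq ?_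
    have hy0 : y = 0 := by rw [e1, ← h0, mul_zero]
    rw [hy0, ← h0] at hr1 hr2
    have hz : blockVec (k * m) m (0 / (s ^ 2 + 0 ^ 2)) (0 / (s ^ 2 + 0 ^ 2)) = 0 := by
      ext i
      simp [blockVec]
    exact Prod.ext (hr1.trans hz) (hr2.trans hz)
  exact ⟨x, y, hx0, by rw [e1]; positivity, hX, hY, hr1, hr2.trans hr1.symm⟩

theorem isMasterSolution_of_scalar {k m : ℕ} (hk : 1 ≤ k) (hm : 1 ≤ m) {s x y : ℝ}
    (hs : 0 < s) (hx : 0 < x) (hy : 0 < y) (h1 : x = y / (s ^ 2 + y ^ 2) / k)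
    (h2 : y = (k - 1) / k * (x / (s ^ 2 + x ^ 2))) :
    (blockVec (k * m) m (y / (s ^ 2 + y ^ 2)) (x / (s ^ 2 + x ^ 2)),
        blockVec (k * m) m (y / (s ^ 2 + y ^ 2)) (x / (s ^ 2 + x ^ 2))) ≠ 0 ∧
    IsMasterSolution (normVar (blockProfile k m)) s
      (blockVec (k * m) m (y / (s ^ 2 + y ^ 2)) (x / (s ^ 2 + x ^ 2)),
        blockVec (k * m) m (y / (s ^ 2 + y ^ 2)) (x / (s ^ 2 + x ^ 2))) := by
  have hpos : ∀ i, 0 < blockVec (k * m) m (y / (s ^ 2 + y ^ 2)) (x / (s ^ 2 + x ^ 2)) i := by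
    intro i
    simp only [blockVec]
    split_ifs <;> positivity
  have heq : ∀ i, blockVec (k * m) m (y / (s ^ 2 + y ^ 2)) (x / (s ^ 2 + x ^ 2)) i =
      (blockVec (k * m) m y x i) / (s ^ 2 + blockVec (k * m) m y x i * blockVec (k * m) m y x i) := by
    intro i
    by_cases hi : i.val < m <;> simp [blockVec, hi, sq]
  refine ⟨fun h => ?_, fun i => (hpos i).le, fun i => (hpos i).le, ?_, ?_, rfl⟩
  · have := congrFun (congrArg Prod.fst h) ⟨0, by positivity⟩
    exact (hpos _).ne' this
  all_goals
    intro i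
    simp only [normVar_transpose, normVar_mulVec_blockVec hk hm, ← h1, ← h2]
    exact heq i

theorem existsUnique_isMasterSolution {k m : ℕ} (hk : 2 ≤ k) (hm : 1 ≤ m) {s : ℝ}
    (hs : 0 < s) (h : s < rhoStar k) :
    ∃! p, p ≠ 0 ∧ IsMasterSolution (normVar (blockProfile k m)) s p := by
  obtain ⟨x, y, hx, hy, h1, h2⟩ := master_scalar_exists hk hs h
  refine ⟨_, isMasterSolution_of_scalar (by omega) hm hs hx hy h1 h2, fun q hq => ?_⟩
  obtain ⟨x', y', hx', hy', h1', h2', hq1, hq2⟩ := hq.2.exists_scalar hk hm hs hq.1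
  obtain ⟨-, ex, ey⟩ := master_scalar hk hs hx hy h1 h2
  obtain ⟨-, ex', ey'⟩ := master_scalar hk hs hx' hy' h1' h2'
  obtain rfl : x = x' := (pow_left_inj₀ hx.le hx'.le two_ne_zero).1 (ex.trans ex'.symm)
  obtain rfl : y = y' := (pow_left_inj₀ hy.le hy'.le two_ne_zero).1 (ey.trans ey'.symm)
  exact Prod.ext hq1 (hq2.trans hq1)

theorem dotProduct_blockVec {k m : ℕ} (hk : 1 ≤ k) (hm : 1 ≤ m) (a b a' b' : ℝ) :
    1 / ((k * m : ℕ) : ℝ) * (blockVec (k * m) m a b ⬝ᵥ blockVec (k * m) m a' b') =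
      a * a' / k + (k - 1) / k * (b * b') := by
  have : blockVec (k * m) m a b ⬝ᵥ blockVec (k * m) m a' b' =
      ∑ i, blockVec (k * m) m (a * a') (b * b') i := by
    refine Finset.sum_congr rfl fun i _ => ?_
    by_cases hi : i.val < m <;> simp [blockVec, hi]
  rw [this, one_div, ← headMean_add_tailMean m, headMean_blockVec hk hm, tailMean_blockVec hk hm]

theorem masterF_of_lt {k m : ℕ} (hk : 2 ≤ k) (hm : 1 ≤ m) {s : ℝ} (hs : 0 < s)
    (h : s < rhoStar k) : masterF (normVar (blockProfile k m)) s = profileF k s := by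
  have hk' : 1 ≤ k := by omega
  have hcond : s < √(specRad (normVar (blockProfile k m))) ∧
      ∃ p, p ≠ 0 ∧ IsMasterSolution (normVar (blockProfile k m)) s p := by
    rw [sqrt_specRad_blockProfile hk' hm]
    exact ⟨h, (existsUnique_isMasterSolution hk hm hs h).exists⟩
  have hspec := hcond.2.choose_spec
  have hM : masterSolution (normVar (blockProfile k m)) s = hcond.2.choose := by
    rw [masterSolution, dif_pos hcond]
  rw [← hM] at hspec
  obtain ⟨x, y, hx, hy, h1, h2, hq1, hq2⟩ := hspec.2.exists_scalar hk hm hs hspec.1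
  obtain ⟨hw, -, -⟩ := master_scalar hk hs hx hy h1 h2
  rw [masterF, hq2, hq1, normVar_mulVec_blockVec hk' hm, ← h1, ← h2, dotProduct_blockVec hk' hm]
  -- The scalar equations turn each block's contribution into `x y`.
  have : y / (s ^ 2 + y ^ 2) * y / k + (k - 1) / k * (x / (s ^ 2 + x ^ 2) * x) = 2 * (x * y) := by
    linear_combination -y * h1 - x * h2
  rw [this, hw, masterW]
  ring

theorem masterF_of_le {k m : ℕ} (hk : 1 ≤ k) (hm : 1 ≤ m) {s : ℝ}
    (h : rhoStar k ≤ s) : masterF (normVar (blockProfile k m)) s = 1 := by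
  have : masterSolution (normVar (blockProfile k m)) s = 0 := by
    rw [masterSolution, dif_neg]
    rw [sqrt_specRad_blockProfile hk hm]
    exact fun hc => absurd hc.1 h.not_gt
  simp [masterF, this]

theorem radialCDF_of_mem {k m : ℕ} (hk : 2 ≤ k) (hm : 1 ≤ m) {s : ℝ} (hs : 0 ≤ s)
    (h : s ≤ rhoStar k) : radialCDF (normVar (blockProfile k m)) s = profileF k s := by
  rcases hs.eq_or_lt with rfl | hs
  · rw [radialCDF, if_neg (lt_irrefl _)]
    refine Tendsto.limUnder_eq ?_
    refine (((continuous_profileF k).tendsto 0).mono_left nhdsWithin_le_nhds).congr' ?_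
    filter_upwards [Ioo_mem_nhdsGT (rhoStar_pos hk)] with s hs
    exact (masterF_of_lt hk hm hs.1 hs.2).symm
  · rw [radialCDF, if_pos hs]
    rcases h.eq_or_lt with rfl | h
    -- At `ρ*` the solution is zero by convention, and the closed form also equals 1 there.
    · rw [masterF_of_le (by omega) hm le_rfl, profileF_rhoStar (by omega)]
    · exact masterF_of_lt hk hm hs h

theorem radialCDF_of_lt {k m : ℕ} (hk : 1 ≤ k) (hm : 1 ≤ m) {s : ℝ}
    (h : rhoStar k < s) : radialCDF (normVar (blockProfile k m)) s = 1 := by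
  rw [radialCDF, if_pos ((rhoStar_nonneg hk).trans_lt h), masterF_of_le hk hm h.le]

/-! ### The radial density -/

/-- `s > 0` keeps the radicand positive also for `k = 2`. The endpoint `ρ*` is allowed because the
closed form is smooth across it. -/
theorem hasDerivAt_profileF {k : ℕ} (hk : 2 ≤ k) {s : ℝ} (hs : 0 < s) (h : s ≤ rhoStar k) :
    HasDerivAt (profileF k) (2 * Real.pi * s * phiInf k s) s := by
  have hk0 : (0 : ℝ) < k := by positivity
  have hpos : 0 < ((k : ℝ) - 2) ^ 2 + 4 * k ^ 2 * s ^ 4 := by positivity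
  have h1 : HasDerivAt (fun s : ℝ => ((k : ℝ) - 2) ^ 2 + 4 * k ^ 2 * s ^ 4)
      (4 * k ^ 2 * (4 * s ^ 3)) s := by
    simpa using ((hasDerivAt_pow 4 s).const_mul (4 * (k : ℝ) ^ 2)).const_add (((k : ℝ) - 2) ^ 2)
  refine ((h1.sqrt hpos.ne').const_mul (1 / (k : ℝ))).congr_deriv ?_
  rw [phiInf, if_pos h]
  have := Real.sqrt_pos.2 hpos
  have := Real.pi_pos
  field_simp
  ring

theorem hasDerivAt_radialCDF {k m : ℕ} (hk : 2 ≤ k) (hm : 1 ≤ m) {s : ℝ} (hs : 0 < s)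
    (h : s < rhoStar k) : HasDerivAt (radialCDF (normVar (blockProfile k m)))
      (2 * Real.pi * s * phiInf k s) s := by
  refine (hasDerivAt_profileF hk hs h.le).congr_of_eventuallyEq ?_
  filter_upwards [Ioo_mem_nhds hs h] with x hx
  exact radialCDF_of_mem hk hm hx.1.le hx.2.le

theorem tendsto_radialCDF_rhoStar {k m : ℕ} (hk : 2 ≤ k) (hm : 1 ≤ m) :
    Tendsto (radialCDF (normVar (blockProfile k m))) (𝓝[<] (rhoStar k)) (𝓝 1) := by
  have h1 := ((continuous_profileF k).tendsto (rhoStar k)).mono_left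
    (nhdsWithin_le_nhds (s := Set.Iio (rhoStar k)))
  rw [profileF_rhoStar (by omega)] at h1
  refine h1.congr' ?_
  filter_upwards [Ioo_mem_nhdsLT (rhoStar_pos hk)] with x hx
  exact (radialCDF_of_mem hk hm hx.1.le hx.2.le).symm

/-- For `k = 2` this is the convention `0 / 0 = 0`: the density equals `2/π` at small nonzero radii,
so continuity needs `k ≥ 3`. -/
theorem phiInf_zero (k : ℕ) : phiInf k 0 = 0 := by
  simp [phiInf]

theorem continuousAt_phiInf_zero {k : ℕ} (hk : 3 ≤ k) : ContinuousAt (phiInf k) 0 := by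
  have h3 : (3 : ℝ) ≤ k := by exact_mod_cast hk
  have hc : ContinuousAt (fun r : ℝ => 4 * k / Real.pi *
      (r ^ 2 / √(((k : ℝ) - 2) ^ 2 + 4 * k ^ 2 * r ^ 4))) 0 := by
    refine Continuous.continuousAt (continuous_const.mul ((by fun_prop : Continuous _).div
      (by fun_prop) fun r => ?_))
    have : 0 < (k : ℝ) - 2 := by linarith
    positivity
  refine hc.congr ?_
  filter_upwards [Iio_mem_nhds (rhoStar_pos (k := k) (by omega))] with r hr
  rw [phiInf, if_pos (le_of_lt hr)]

end VarianceProfile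

/-! ### Rotation invariant measures and the law of the modulus -/

namespace VarianceProfile

open scoped Real ENNReal

/-- The mean over the unit circle of the indicator of `A` dilated by `r`. -/
noncomputable def angularMass (A : Set ℂ) (z : ℂ) : ℝ≥0∞ :=
  ∫⁻ θ in Set.Ioc (0 : ℝ) (2 * π), A.indicator 1 ((Circle.exp θ : ℂ) * z)

/-- A rotation shifts the angle, and a periodic function has the same integral over every period. -/
theorem angularMass_circle_mul (A : Set ℂ) (u : Circle) (z : ℂ) :
    angularMass A ((u : ℂ) * z) = angularMass A z := by
  obtain ⟨a, rfl⟩ := Circle.exp_surjective u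
  set f : ℝ → ℝ≥0∞ := fun θ => A.indicator 1 ((Circle.exp θ : ℂ) * z) with hf
  have hper : Function.Periodic f (2 * π) := fun θ => by
    simp only [hf, Circle.periodic_exp θ]
  have hshift : ∫⁻ θ in Set.Ioc (0 : ℝ) (2 * π), f (θ + a) =
      ∫⁻ θ in Set.Ioc a (a + 2 * π), f θ := by
    rw [← (measurePreserving_add_right volume a).setLIntegral_comp_preimage_emb
      (measurableEmbedding_addRight a) f (Set.Ioc a (a + 2 * π)), Set.preimage_add_const_Ioc, sub_self, add_sub_cancel_left]
  have hdom : ∫⁻ θ in Set.Ioc a (a + 2 * π), f θ = ∫⁻ θ in Set.Ioc (0 : ℝ) (2 * π), f θ := by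
    have h0 := isAddFundamentalDomain_Ioc Real.two_pi_pos 0
    rw [zero_add] at h0
    refine (isAddFundamentalDomain_Ioc Real.two_pi_pos a).setLIntegral_eq h0 f ?_
    rintro ⟨g, hg⟩ x
    obtain ⟨j, rfl⟩ := AddSubgroup.mem_zmultiples_iff.1 hg
    rw [AddSubgroup.mk_vadd, vadd_eq_add, add_comm]
    exact hper.zsmul j x
  rw [angularMass, angularMass, ← hdom, ← hshift]
  refine lintegral_congr fun θ => ?_
  simp only [hf, Circle.exp_add, Circle.coe_mul, mul_assoc]

theorem angularMass_norm (A : Set ℂ) (z : ℂ) : angularMass A (‖z‖ : ℂ) = angularMass A z := by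
  have : z = (Circle.exp z.arg : ℂ) * (‖z‖ : ℂ) := by
    rw [Circle.coe_exp, mul_comm, Complex.norm_mul_exp_arg_mul_I]
  conv_rhs => rw [this]
  exact (angularMass_circle_mul A _ _).symm

theorem measurable_indicator_circle {A : Set ℂ} (hA : MeasurableSet A) :
    Measurable (fun p : ℂ × ℝ => A.indicator (1 : ℂ → ℝ≥0∞) ((Circle.exp p.2 : ℂ) * p.1)) := by
  refine (measurable_one.indicator hA).comp ?_
  refine Continuous.measurable ?_
  fun_prop

theorem measurable_angularMass {A : Set ℂ} (hA : MeasurableSet A) :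
    Measurable (angularMass A) :=
  (measurable_indicator_circle hA).lintegral_prod_right'

/-- A rotation invariant measure is determined by the law of the modulus. -/
theorem lintegral_angularMass {μ : Measure ℂ} [SFinite μ]
    (hμ : ∀ u : Circle, μ.map (fun z : ℂ => (u : ℂ) * z) = μ) {A : Set ℂ} (hA : MeasurableSet A) :
    ∫⁻ r, angularMass A (r : ℂ) ∂(μ.map (fun z : ℂ => ‖z‖)) = ENNReal.ofReal (2 * π) * μ A := by
  rw [lintegral_map (f := fun r : ℝ => angularMass A (r : ℂ))
    ((measurable_angularMass hA).comp Complex.measurable_ofReal) measurable_norm]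
  simp_rw [angularMass_norm]
  unfold angularMass
  -- After Tonelli, rotation invariance makes the inner integral `μ A` for every angle.
  rw [lintegral_lintegral_swap (measurable_indicator_circle hA).aemeasurable]
  have : ∀ θ : ℝ, ∫⁻ z, A.indicator 1 ((Circle.exp θ : ℂ) * z) ∂μ = μ A := by
    intro θ
    rw [← lintegral_map (f := A.indicator 1) (measurable_one.indicator hA) (by fun_prop), hμ,
      lintegral_indicator_one hA]
  simp_rw [this]
  simp [mul_comm]

theorem radial_measure_ext {μ ν : Measure ℂ} [SFinite μ] [SFinite ν]
    (hμ : ∀ u : Circle, μ.map (fun z : ℂ => (u : ℂ) * z) = μ)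
    (hν : ∀ u : Circle, ν.map (fun z : ℂ => (u : ℂ) * z) = ν)
    (h : μ.map (fun z : ℂ => ‖z‖) = ν.map (fun z : ℂ => ‖z‖)) : μ = ν := by
  ext A hA
  have h1 := lintegral_angularMass hμ hA
  rw [h, lintegral_angularMass hν hA] at h1
  exact ((ENNReal.mul_right_inj (by simp [Real.pi_pos]) ENNReal.ofReal_ne_top).1 h1).symm

theorem IsMasterMeasure.unique {n : ℕ} {V : Matrix (Fin n) (Fin n) ℝ} {μ ν : Measure ℂ}
    (hμ : IsMasterMeasure V μ) (hν : IsMasterMeasure V ν) : μ = ν := by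
  have := hμ.prob
  have := hν.prob
  refine radial_measure_ext hμ.radial hν.radial ?_
  have key : ∀ {κ : Measure ℂ}, IsProbabilityMeasure κ → ∀ s,
      ProbabilityTheory.cdf (κ.map (fun z : ℂ => ‖z‖)) s = κ.real {z : ℂ | ‖z‖ ≤ s} := by
    intro κ _ s
    have := Measure.isProbabilityMeasure_map (μ := κ) (f := fun z : ℂ => ‖z‖)
      measurable_norm.aemeasurable
    rw [ProbabilityTheory.cdf_eq_real, map_measureReal_apply measurable_norm measurableSet_Iic]
    rfl
  have := Measure.isProbabilityMeasure_map (μ := μ) (f := fun z : ℂ => ‖z‖)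
    measurable_norm.aemeasurable
  have := Measure.isProbabilityMeasure_map (μ := ν) (f := fun z : ℂ => ‖z‖)
    measurable_norm.aemeasurable
  refine Measure.eq_of_cdf _ _ (StieltjesFunction.ext fun s => ?_)
  have hpos : ∀ s : ℝ, 0 < s → ProbabilityTheory.cdf (μ.map (fun z : ℂ => ‖z‖)) s =
      ProbabilityTheory.cdf (ν.map (fun z : ℂ => ‖z‖)) s := by
    intro s hs
    rw [key hμ.prob, key hν.prob, hμ.cdf s hs, hν.cdf s hs]
  rcases lt_trichotomy s 0 with hs | rfl | hs
  · have : {z : ℂ | ‖z‖ ≤ s} = ∅ :=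
      Set.eq_empty_of_forall_notMem fun z hz => (hz.trans_lt hs).not_ge (norm_nonneg z)
    rw [key hμ.prob, key hν.prob, this]
    simp
  -- The value at `0` is not prescribed; right continuity recovers it from `s > 0`.
  · have h1 := ((ProbabilityTheory.cdf (μ.map (fun z : ℂ => ‖z‖))).right_continuous 0).mono
      Set.Ioi_subset_Ici_self
    have h2 := ((ProbabilityTheory.cdf (ν.map (fun z : ℂ => ‖z‖))).right_continuous 0).mono
      Set.Ioi_subset_Ici_self
    refine tendsto_nhds_unique h1 (Tendsto.congr' ?_ h2)
    filter_upwards [self_mem_nhdsWithin] with s hs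
    exact (hpos s hs).symm
  · exact hpos s hs

/-! ### Verification of the limit measure -/

theorem measurable_phiInf (k : ℕ) : Measurable (phiInf k) := by
  unfold phiInf
  refine Measurable.ite measurableSet_Iic ?_ measurable_const
  fun_prop

theorem phiInf_nonneg (k : ℕ) (r : ℝ) : 0 ≤ phiInf k r := by
  have := Real.pi_pos
  unfold phiInf
  split_ifs <;> positivity

theorem lintegral_ball_of_norm {f : ℝ → ℝ≥0∞} (hf : Measurable f) (s : ℝ) :
    ∫⁻ z in {z : ℂ | ‖z‖ ≤ s}, f ‖z‖ =
      ENNReal.ofReal (2 * π) * ∫⁻ r in Set.Ioc 0 s, ENNReal.ofReal r * f r := by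
  have hball : MeasurableSet {z : ℂ | ‖z‖ ≤ s} := measurableSet_le measurable_norm measurable_const
  set g : ℝ → ℝ≥0∞ := fun r => ENNReal.ofReal r * (Set.Iic s).indicator f r with hg
  have hgm : Measurable g := by
    have := hf.indicator (measurableSet_Iic (a := s))
    fun_prop
  rw [← lintegral_indicator hball, ← Complex.lintegral_comp_polarCoord_symm]
  have h1 : ∫⁻ p in polarCoord.target, ENNReal.ofReal p.1 •
      ({z : ℂ | ‖z‖ ≤ s}.indicator (fun z => f ‖z‖) (Complex.polarCoord.symm p)) =
      ∫⁻ p in polarCoord.target, g p.1 * 1 := by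
    refine setLIntegral_congr_fun polarCoord.open_target.measurableSet fun p hp => ?_
    have hp0 : |p.1| = p.1 := abs_of_pos hp.1
    simp only [hg, Set.indicator_apply, Set.mem_ofPred_eq, Complex.norm_polarCoord_symm, hp0,
      smul_eq_mul, mul_one, Set.mem_Iic]
  rw [h1, polarCoord_target, Measure.volume_eq_prod, ← Measure.prod_restrict,
    lintegral_prod_mul hgm.aemeasurable aemeasurable_const, mul_comm]
  congr 1
  · simp [two_mul]
  · simp only [hg]
    rw [← Set.Iic_inter_Ioi, ← Measure.restrict_restrict measurableSet_Iic,
      ← lintegral_indicator measurableSet_Iic]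
    refine lintegral_congr fun r => ?_
    by_cases hr : r ≤ s <;> simp [hr]

theorem lintegral_phiInf {k : ℕ} (hk : 2 ≤ k) {s : ℝ} (hs : 0 ≤ s) (h : s ≤ rhoStar k) :
    ∫⁻ z in {z : ℂ | ‖z‖ ≤ s}, ENNReal.ofReal (phiInf k ‖z‖) =
      ENNReal.ofReal (profileF k s - profileF k 0) := by
  rw [lintegral_ball_of_norm (f := fun r => ENNReal.ofReal (phiInf k r))
    (measurable_phiInf k).ennreal_ofReal, ← lintegral_const_mul' _ _ ENNReal.ofReal_ne_top]
  have hderiv : ∀ r ∈ Set.Ioo 0 s, HasDerivAt (profileF k) (2 * π * r * phiInf k r) r :=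
    fun r hr => hasDerivAt_profileF hk hr.1 (hr.2.le.trans h)
  have hnn : ∀ r, 0 ≤ r → 0 ≤ 2 * π * r * phiInf k r := fun r hr => by
    have := phiInf_nonneg k r
    have := Real.pi_pos
    positivity
  -- A nonnegative derivative of a continuous function is integrable; only the open interval
  -- matters, so nothing is needed at `0`.
  have hint := intervalIntegral.integrableOn_deriv_of_nonneg
    (continuous_profileF k).continuousOn hderiv fun r hr => hnn r hr.1.le
  have hFTC := intervalIntegral.integral_eq_sub_of_hasDerivAt_of_le hs
    (continuous_profileF k).continuousOn hderiv
    ((intervalIntegrable_iff_integrableOn_Ioc_of_le hs).2 hint)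
  rw [← hFTC, intervalIntegral.integral_of_le hs, ofReal_integral_eq_lintegral_ofReal hint
    (ae_restrict_of_forall_mem measurableSet_Ioc fun r hr => hnn r hr.1.le)]
  refine setLIntegral_congr_fun measurableSet_Ioc fun r hr => ?_
  have := Real.pi_pos
  have hr0 := hr.1
  rw [ENNReal.ofReal_mul (p := 2 * π * r) (by positivity),
    ENNReal.ofReal_mul (p := 2 * π) (by positivity), mul_assoc]

theorem lintegral_phiInf_of_ge {k : ℕ} (hk : 2 ≤ k) {s : ℝ} (h : rhoStar k ≤ s) :
    ∫⁻ z in {z : ℂ | ‖z‖ ≤ s}, ENNReal.ofReal (phiInf k ‖z‖) =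
      ENNReal.ofReal (1 - profileF k 0) := by
  rw [← profileF_rhoStar (k := k) (by omega), ← lintegral_phiInf hk (rhoStar_pos hk).le le_rfl]
  have hball : ∀ s : ℝ, MeasurableSet {z : ℂ | ‖z‖ ≤ s} := fun s =>
    measurableSet_le measurable_norm measurable_const
  rw [← lintegral_indicator (hball s), ← lintegral_indicator (hball _)]
  congr 1
  ext z
  by_cases hz : ‖z‖ ≤ rhoStar k
  · simp [hz, hz.trans h]
  · simp [Set.indicator_apply, phiInf, hz]

theorem muInf_ball {k : ℕ} (hk : 2 ≤ k) {s : ℝ} (hs : 0 < s) :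
    muInf k {z : ℂ | ‖z‖ ≤ s} =
      ENNReal.ofReal (profileF k 0) + ∫⁻ z in {z : ℂ | ‖z‖ ≤ s}, ENNReal.ofReal (phiInf k ‖z‖) := by
  have hball : MeasurableSet {z : ℂ | ‖z‖ ≤ s} := measurableSet_le measurable_norm measurable_const
  rw [muInf, Measure.add_apply, Measure.smul_apply, withDensity_apply _ hball,
    Measure.dirac_apply' _ hball, profileF_zero hk]
  simp [hs.le]

theorem isProbabilityMeasure_muInf {k : ℕ} (hk : 2 ≤ k) : IsProbabilityMeasure (muInf k) := by
  have h0 := profileF_lt_one (by omega : 1 ≤ k) le_rfl (rhoStar_pos hk)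
  have hval : ∀ s, rhoStar k ≤ s → muInf k {z : ℂ | ‖z‖ ≤ s} = 1 := fun s hs => by
    rw [muInf_ball hk ((rhoStar_pos hk).trans_le hs), lintegral_phiInf_of_ge hk hs,
      ← ENNReal.ofReal_add (profileF_nonneg k 0) (by linarith)]
    simp
  refine ⟨?_⟩
  -- The plane is the increasing union of discs, whose mass is 1 from radius `ρ*` on.
  have hmono : Monotone fun s : ℝ => {z : ℂ | ‖z‖ ≤ s} := fun a b hab z hz => le_trans hz hab
  have huniv : ⋃ s : ℝ, {z : ℂ | ‖z‖ ≤ s} = Set.univ :=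
    Set.eq_univ_of_forall fun z => Set.mem_iUnion.2 ⟨‖z‖, le_refl ‖z‖⟩
  have ht := tendsto_measure_iUnion_atTop (μ := muInf k) hmono
  rw [huniv] at ht
  refine tendsto_nhds_unique ht (tendsto_const_nhds.congr' ?_)
  filter_upwards [eventually_ge_atTop (rhoStar k)] with s hs
  exact (hval s hs).symm

theorem muInf_map_circle_mul (k : ℕ) (u : Circle) :
    (muInf k).map (fun z : ℂ => (u : ℂ) * z) = muInf k := by
  have hm : Measurable (fun z : ℂ => (u : ℂ) * z) := by fun_prop
  have hmp : MeasurePreserving (fun z : ℂ => (u : ℂ) * z) :=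
    (rotation u).measurePreserving
  rw [muInf, Measure.map_add _ _ hm, Measure.map_smul, Measure.map_dirac' hm, mul_zero]
  congr 1
  ext A hA
  rw [Measure.map_apply hm hA, withDensity_apply _ hA, withDensity_apply _ (hm hA)]
  have hd : Measurable fun z : ℂ => ENNReal.ofReal (phiInf k ‖z‖) :=
    ((measurable_phiInf k).comp measurable_norm).ennreal_ofReal
  rw [← hmp.setLIntegral_comp_preimage hA hd]
  simp only [norm_mul, Circle.norm_coe, one_mul]

theorem isMasterMeasure_muInf {k m : ℕ} (hk : 2 ≤ k) (hm : 1 ≤ m) :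
    IsMasterMeasure (normVar (blockProfile k m)) (muInf k) := by
  refine ⟨isProbabilityMeasure_muInf hk, muInf_map_circle_mul k, fun s hs => ?_⟩
  have h0 := profileF_nonneg k 0
  have hmono : profileF k 0 ≤ profileF k s := by
    unfold profileF
    gcongr
  rw [Measure.real, muInf_ball hk hs]
  rcases le_or_gt s (rhoStar k) with h | h
  · rw [lintegral_phiInf hk hs.le h, radialCDF_of_mem hk hm hs.le h,
      ← ENNReal.ofReal_add h0 (by linarith), add_sub_cancel,
      ENNReal.toReal_ofReal (profileF_nonneg k s)]
  · have h1 := profileF_lt_one (by omega : 1 ≤ k) le_rfl (rhoStar_pos hk)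
    rw [lintegral_phiInf_of_ge hk h.le, radialCDF_of_lt (by omega) hm h,
      ← ENNReal.ofReal_add h0 (by linarith), add_sub_cancel, ENNReal.toReal_ofReal zero_le_one]

theorem isMasterMeasure_iff {k m : ℕ} (hk : 2 ≤ k) (hm : 1 ≤ m) (μ : Measure ℂ) :
    IsMasterMeasure (normVar (blockProfile k m)) μ ↔ μ = muInf k :=
  ⟨fun h => h.unique (isMasterMeasure_muInf hk hm), fun h => h ▸ isMasterMeasure_muInf hk hm⟩

end VarianceProfile

open VarianceProfile in
theorem proposition3p5 (k : ℕ) (hk : 1 ≤ k) :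
    -- the spectral radius
    (∀ m : ℕ, 1 ≤ m →
      specRad (normVar (blockProfile k m)) = √((k : ℝ) - 1) / k ∧
      √(specRad (normVar (blockProfile k m))) = rhoStar k) ∧
    -- bounded variances and admissibility, along `n = k m`, `m ≥ 1`
    BoundedVariances (fun m : ℕ+ => blockProfile k (m : ℕ)) ∧
    Admissible (fun m : ℕ+ => blockProfile k (m : ℕ)) ∧
    (2 ≤ k → ∀ m : ℕ, 1 ≤ m →
      -- the nontrivial solution of the Master Equations is well defined
      (∀ s : ℝ, 0 < s → s < rhoStar k →
        ∃! p, p ≠ 0 ∧ IsMasterSolution (normVar (blockProfile k m)) s p) ∧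
      -- the function `F_n`
      (∀ s : ℝ, 0 ≤ s → s ≤ rhoStar k →
        radialCDF (normVar (blockProfile k m)) s =
          1 / (k : ℝ) * √(((k : ℝ) - 2) ^ 2 + 4 * k ^ 2 * s ^ 4)) ∧
      (∀ s : ℝ, rhoStar k < s → radialCDF (normVar (blockProfile k m)) s = 1) ∧
      radialCDF (normVar (blockProfile k m)) 0 = 1 - 2 / (k : ℝ) ∧
      Tendsto (radialCDF (normVar (blockProfile k m))) (𝓝[<] (rhoStar k)) (𝓝 1) ∧
      -- the measure `μ_n` and its density
      (∀ μ : Measure ℂ, IsMasterMeasure (normVar (blockProfile k m)) μ ↔ μ = muInf k) ∧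
      (∀ s : ℝ, 0 < s → s < rhoStar k →
        HasDerivAt (radialCDF (normVar (blockProfile k m)))
          (2 * Real.pi * s * phiInf k s) s)) ∧
    (3 ≤ k → phiInf k 0 = 0 ∧ ContinuousAt (phiInf k) 0) := by
  refine ⟨fun m hm => ⟨specRad_blockProfile hk hm, sqrt_specRad_blockProfile hk hm⟩,
    boundedVariances_blockProfile k, admissible_blockProfile hk, fun hk2 m hm => ⟨?_, ?_, ?_, ?_,
      tendsto_radialCDF_rhoStar hk2 hm, isMasterMeasure_iff hk2 hm, ?_⟩,
    fun hk3 => ⟨phiInf_zero k, continuousAt_phiInf_zero hk3⟩⟩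
  · exact fun s hs h => existsUnique_isMasterSolution hk2 hm hs h
  · exact fun s hs h => radialCDF_of_mem hk2 hm hs h
  · exact fun s h => radialCDF_of_lt hk hm h
  · rw [radialCDF_of_mem hk2 hm le_rfl (rhoStar_nonneg hk), profileF_zero hk2]
  · exact fun s hs h => hasDerivAt_radialCDF hk2 hm hs h
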